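/- Let $L|K$ be a finite Galois extension of fields, and let $\nu$ be a (Krull) valuation on the field $L$, written additively, with value group $\nu L=\nu(L\setminus\{0\})$, and restricted to $K$, with $\nu K=\nu(K\setminus\{0\})$. For $l\in L$ put $\nu(l-K)=\{\nu(l-x)\mid x\in K,\ x\neq l\}$. Assume that 1. $\nu$ is archimedean, i.e. the ordered group $\nu L$ embeds in $(\mathbb R,+,\le)$; 2. $(L|K,\nu)$ is immediate, i.e. for every $l\in L$ the set $\nu(l-K)$ is contained in $\nu K$ and has no maximal element; 3. $(L|K,\nu)$ is defectless, i.e. (for a finite immediate extension) the restriction of $\nu$ to $K$ has exactly $[L:K]$ distinct extensions to a valuation of $L$ (up to equivalence). Then $(L|K,\nu)$ is dense, i.e. every element of $L$ is limit over $K$: for every $l\in L$, $\nu(l-K)=\nu K$. -/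

import Mathlib

namespace ValuedExtension

section ModuleNotions

variable {K L Γ : Type*} [Field K] [Field L] [Algebra K L]
  [AddCommGroup Γ] [LinearOrder Γ] [IsOrderedAddMonoid Γ]

/-- `νM`, the set of values of the nonzero elements of the `K`-submodule `M` of `L`. -/
def values (ν : AddValuation L (WithTop Γ)) (M : Submodule K L) : Set Γ :=
  {γ | ∃ x ∈ M, x ≠ 0 ∧ ν x = (γ : WithTop Γ)}

/-- `ν(l - M)`, the set of values `ν (l - x)` for `x` in `M`, `x ≠ l`. -/
def valuesSub (ν : AddValuation L (WithTop Γ)) (l : L) (M : Submodule K L) : Set Γ :=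
  {γ | ∃ x ∈ M, x ≠ l ∧ ν (l - x) = (γ : WithTop Γ)}

/-- `l` is pseudo-limit over `(M, ν)`: `ν(l - M) ⊆ νM`, and `ν(l - M)` has no maximal element. -/
def IsPseudoLimit (ν : AddValuation L (WithTop Γ)) (l : L) (M : Submodule K L) : Prop :=
  valuesSub ν l M ⊆ values ν M ∧ ¬ ∃ γ, IsGreatest (valuesSub ν l M) γ

/-- `l` is limit over `(M, ν)`: `ν(l - M) = νM`. -/
def IsLimit (ν : AddValuation L (WithTop Γ)) (l : L) (M : Submodule K L) : Prop :=
  valuesSub ν l M = values ν M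

/-- `(N|M, ν)` is immediate: every element of `N` is pseudo-limit over `(M, ν)`. -/
def IsImmediate (ν : AddValuation L (WithTop Γ)) (M N : Submodule K L) : Prop :=
  ∀ l ∈ N, IsPseudoLimit ν l M

/-- `(N|M, ν)` is dense: every element of `N` is limit over `(M, ν)`. -/
def IsDense (ν : AddValuation L (WithTop Γ)) (M N : Submodule K L) : Prop :=
  ∀ l ∈ N, IsLimit ν l M

end ModuleNotions

section FieldNotions

variable (K : Type*) {L Γ : Type*} [Field K] [Field L] [Algebra K L]
  [AddCommGroup Γ] [LinearOrder Γ] [IsOrderedAddMonoid Γ]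

/-- The valued field extension `(L|K, ν)` is immediate. Here `1 : Submodule K L` is the image of
`K` in `L`. -/
def IsImmediateExtension (ν : AddValuation L (WithTop Γ)) : Prop :=
  IsImmediate ν (1 : Submodule K L) ⊤

/-- The valued field extension `(L|K, ν)` is dense. -/
def IsDenseExtension (ν : AddValuation L (WithTop Γ)) : Prop :=
  IsDense ν (1 : Submodule K L) ⊤

/-- The extensions to `L` of the restriction of `ν` to `K`. Valuations are taken up to equivalence,
and each class is represented by its valuation ring, a valuation subring of `L`. -/
def extensions (ν : AddValuation L (WithTop Γ)) : Set (ValuationSubring L) :=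
  {A | (A.valuation.comap (algebraMap K L)).IsEquiv
    (AddValuation.toValuation (ν.comap (algebraMap K L)))}

/-- A finite immediate extension `(L|K, ν)` is defectless if the restriction of `ν` to `K` has
`[L : K]` distinct extensions to `L`. -/
def IsDefectless (ν : AddValuation L (WithTop Γ)) : Prop :=
  (extensions K ν).encard = Module.finrank K L

/-- The value group `νL`. -/
def valueGroup (ν : AddValuation L (WithTop Γ)) : AddSubgroup Γ where
  carrier := {γ | ∃ x : L, ν x = (γ : WithTop Γ)}
  zero_mem' := ⟨1, by simp⟩
  add_mem' := by
    rintro a b ⟨x, hx⟩ ⟨y, hy⟩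
    exact ⟨x * y, by rw [ν.map_mul, hx, hy, WithTop.coe_add]⟩
  neg_mem' := by
    rintro a ⟨x, hx⟩
    refine ⟨x⁻¹, ?_⟩
    have hx0 : x ≠ 0 := by
      rintro rfl
      simp at hx
    have h : ν (x * x⁻¹) = 0 := by rw [mul_inv_cancel₀ hx0, ν.map_one]
    rw [ν.map_mul, hx] at h
    cases hc : ν x⁻¹ with
    | top => simp [hc] at h
    | coe c =>
      rw [hc] at h
      have h' : a + c = 0 := by exact_mod_cast h
      rw [eq_neg_of_add_eq_zero_right h']

/-- `ν` is archimedean: `νL` embeds, as an ordered group, in `ℝ`. -/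
def IsArchimedean (ν : AddValuation L (WithTop Γ)) : Prop :=
  ∃ f : valueGroup ν →+ ℝ, StrictMono f

end FieldNotions

end ValuedExtension

/-! Since `ν` is archimedean it comes from a real absolute value `a`, nontrivial on `K` by
immediacy. The Galois group acts transitively on the valuation rings of `L` extending that of `K`
(`exists_eq_unitBall_conj`). Defectlessness provides as many such rings as automorphisms, so the
conjugates of `a` are pairwise inequivalent. Weak approximation then gives `t` close to `l` for `a`
with all `σ t`, `σ ≠ 1`, close to `0`; the trace of `t` lies in `K` and approximates `l`
(`exists_algebraMap_sub_lt`). -/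

open scoped Topology

namespace AbsoluteValue

/-! ### Rank one valuation rings -/

section UnitBall

variable {L : Type*} [Field L]

/-- The valuation ring of a nonarchimedean real absolute value. -/
def unitBall (a : AbsoluteValue L ℝ) (ha : IsNonarchimedean a) : ValuationSubring L where
  carrier := {x | a x ≤ 1}
  mul_mem' {x y} hx hy := by
    simpa using mul_le_one₀ hx (a.nonneg y) hy
  one_mem' := by simp
  add_mem' {x y} hx hy := (ha x y).trans (max_le hx hy)
  zero_mem' := by simp
  neg_mem' {x} hx := by simpa using hx
  mem_or_inv_mem' x := by
    rcases le_total (a x) 1 with h | h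
    · exact Or.inl h
    · exact Or.inr (by simpa using inv_le_one_of_one_le₀ h)

@[simp] theorem mem_unitBall {a : AbsoluteValue L ℝ} {ha : IsNonarchimedean a} {x : L} :
    x ∈ a.unitBall ha ↔ a x ≤ 1 := Iff.rfl

/-- The valuation ring of a nonarchimedean real absolute value is a maximal proper subring. -/
theorem eq_top_or_eq_unitBall {a : AbsoluteValue L ℝ} (ha : IsNonarchimedean a)
    {S : ValuationSubring L} (h : a.unitBall ha ≤ S) : S = ⊤ ∨ S = a.unitBall ha := by
  by_cases hS : S ≤ a.unitBall ha
  · exact Or.inr (le_antisymm hS h)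
  left
  obtain ⟨y, hyS, hy⟩ := SetLike.not_le_iff_exists.1 hS
  have hy1 : 1 < a y := by simpa using hy
  refine top_unique fun z _ ↦ ?_
  obtain ⟨n, hn⟩ := pow_unbounded_of_one_lt (a z) hy1
  have hy0 : y ≠ 0 := by rintro rfl; simp at hy1; linarith
  have hz : z = z / y ^ n * y ^ n := by field_simp
  rw [hz]
  refine mul_mem (h ?_) (pow_mem hyS n)
  rw [mem_unitBall, map_div₀, map_pow]
  exact div_le_one_of_le₀ hn.le (by positivity)

theorem IsEquiv.unitBall_eq {a b : AbsoluteValue L ℝ} (ha : IsNonarchimedean a)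
    (hb : IsNonarchimedean b) (h : a.IsEquiv b) : a.unitBall ha = b.unitBall hb := by
  ext x
  exact h.le_one_iff

/-- Equivalent absolute values that agree on a nontrivial subfield are equal. -/
theorem IsEquiv.eq_of_comp_eq {K : Type*} [Field K] [Algebra K L] {a b : AbsoluteValue L ℝ}
    (h : a.IsEquiv b) (hab : ∀ k : K, a (algebraMap K L k) = b (algebraMap K L k))
    (hnt : ∃ k : K, 1 < a (algebraMap K L k)) : a = b := by
  obtain ⟨c, -, hc⟩ := isEquiv_iff_exists_rpow_eq.1 h
  obtain ⟨k, hk⟩ := hnt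
  have h1 : a (algebraMap K L k) ^ c = a (algebraMap K L k) ^ (1 : ℝ) := by
    rw [Real.rpow_one, hab k, ← hab k]
    exact (congrFun hc _).trans (hab k).symm
  have hc1 : c = 1 := by
    have h2 := congrArg Real.log h1
    rw [Real.log_rpow (by linarith), Real.log_rpow (by linarith)] at h2
    exact mul_right_cancel₀ (Real.log_pos hk).ne' h2
  ext x
  simpa [hc1] using congrFun hc x

end UnitBall

/-! ### Conjugate absolute values -/

section Galois

variable {K L : Type*} [Field K] [Field L] [Algebra K L]

/-- The conjugate `x ↦ a (σ x)` of an absolute value `a`. -/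
abbrev conj (a : AbsoluteValue L ℝ) (σ : L ≃ₐ[K] L) : AbsoluteValue L ℝ :=
  a.comp (f := (σ : L →+* L)) (RingHom.injective _)

@[simp] theorem conj_apply (a : AbsoluteValue L ℝ) (σ : L ≃ₐ[K] L) (x : L) :
    a.conj σ x = a (σ x) := rfl

theorem isNonarchimedean_conj {a : AbsoluteValue L ℝ} (ha : IsNonarchimedean a)
    (σ : L ≃ₐ[K] L) : IsNonarchimedean (a.conj σ) := fun x y ↦ by
  simpa only [conj_apply, map_add] using ha (σ x) (σ y)

variable [FiniteDimensional K L] [IsGalois K L]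

theorem exists_algebraMap_eq_of_fixed {x : L} (hx : ∀ σ : L ≃ₐ[K] L, σ x = x) :
    ∃ k : K, algebraMap K L k = x :=
  IntermediateField.mem_bot.1 ((IsGalois.mem_bot_iff_fixed x).2 hx)

/-- An element all of whose conjugates lie in the valuation ring of `a` lies in every valuation
ring with the same restriction to the base field. -/
theorem mem_of_forall_conj_le_one {a : AbsoluteValue L ℝ} (ha : IsNonarchimedean a)
    {S : ValuationSubring L}
    (hS : ∀ k : K, a (algebraMap K L k) ≤ 1 → algebraMap K L k ∈ S) {x : L}
    (hx : ∀ σ : L ≃ₐ[K] L, a (σ x) ≤ 1) : x ∈ S := by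
  classical
  have := Fintype.ofFinite (L ≃ₐ[K] L)
  -- The coefficients of `∏ (X - σ x)` are Galois-invariant and in the unit ball, hence in `S`; so
  -- `x` is integral over the integrally closed ring `S`.
  let p := MulSemiringAction.charpoly (L ≃ₐ[K] L) x
  have hpa : p ∈ Polynomial.lifts (a.unitBall ha).toSubring.subtype := by
    refine prod_mem fun σ _ ↦ ?_
    refine (Polynomial.mem_lifts _).2 ⟨.X - .C ⟨σ x, hx σ⟩, ?_⟩
    simp [AlgEquiv.smul_def]
  have hcoeff (n : ℕ) : p.coeff n ∈ S := by
    obtain ⟨y, hy⟩ := (Polynomial.lifts_iff_coeff_lifts p).1 hpa n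
    obtain ⟨k, hk⟩ := exists_algebraMap_eq_of_fixed (K := K) (x := p.coeff n) fun σ ↦
      MulSemiringAction.smul_coeff_charpoly x n σ
    rw [← hk]
    exact hS k (hk ▸ hy ▸ y.2)
  have hpS : p ∈ Polynomial.lifts (algebraMap S L) :=
    (Polynomial.lifts_iff_coeff_lifts p).2 fun n ↦ ⟨⟨_, hcoeff n⟩, rfl⟩
  have hmonic : p.Monic := MulSemiringAction.monic_charpoly (L ≃ₐ[K] L) x
  obtain ⟨q, hq, -, hqm⟩ := Polynomial.lifts_and_degree_eq_and_monic hpS hmonic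
  have hint : IsIntegral S x := by
    refine ⟨q, hqm, ?_⟩
    rw [← Polynomial.eval_map, hq]
    exact MulSemiringAction.eval_charpoly (L ≃ₐ[K] L) x
  obtain ⟨y, rfl⟩ := IsIntegrallyClosed.algebraMap_eq_of_integral hint
  exact y.2

/-- The Galois group acts transitively on the valuation rings extending a rank one valuation ring
of the base field. -/
theorem exists_eq_unitBall_conj {a : AbsoluteValue L ℝ} (ha : IsNonarchimedean a)
    (hnt : ∃ k : K, 1 < a (algebraMap K L k)) {S : ValuationSubring L}
    (hS : ∀ k : K, algebraMap K L k ∈ S ↔ a (algebraMap K L k) ≤ 1) :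
    ∃ σ : L ≃ₐ[K] L, S = (a.conj σ).unitBall (isNonarchimedean_conj ha σ) := by
  classical
  -- Indexing by distinct conjugates, not by automorphisms, makes them pairwise inequivalent.
  let W := Set.range (a.conj : (L ≃ₐ[K] L) → AbsoluteValue L ℝ)
  have : Fintype W := Fintype.ofFinite W
  have hW (w : W) : IsNonarchimedean w.1 := by
    obtain ⟨_, σ, rfl⟩ := w
    exact isNonarchimedean_conj ha σ
  have hWK (w : W) (k : K) : w.1 (algebraMap K L k) = a (algebraMap K L k) := by
    obtain ⟨_, σ, rfl⟩ := w
    simp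
  have hmem {x : L} (hx : ∀ w : W, w.1 x ≤ 1) : x ∈ S :=
    mem_of_forall_conj_le_one ha (fun k ↦ (hS k).2) fun σ ↦ hx ⟨a.conj σ, σ, rfl⟩
  have hnontriv (w : W) : w.1.IsNontrivial := by
    obtain ⟨k, hk⟩ := hnt
    rw [← hWK w] at hk
    exact ⟨algebraMap K L k, fun h ↦ by simp [h] at hk; linarith, hk.ne'⟩
  have hineq : Pairwise fun w w' : W ↦ ¬ w.1.IsEquiv w'.1 := fun w w' hne h ↦
    hne <| Subtype.ext <| h.eq_of_comp_eq (fun k ↦ (hWK w k).trans (hWK w' k).symm)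
      (by simpa only [hWK] using hnt)
  choose t ht1 ht using exists_one_lt_lt_one_pi_of_not_isEquiv (v := fun w : W ↦ w.1)
    hnontriv hineq
  -- `e w` has absolute value `1` at `w` and less than `1` at every other conjugate.
  let e (w : W) : L := t w / (1 + t w)
  have he_self (w : W) : w.1 (e w) = 1 := by
    have h : w.1 (1 + t w) = w.1 (t w) :=
      (hW w).add_eq_right_of_lt (by simpa using ht1 w)
    rw [map_div₀, h]
    exact div_self (by linarith [ht1 w])
  have he_lt {w w' : W} (hne : w' ≠ w) : w'.1 (e w) < 1 := by
    have h : w'.1 (1 + t w) = w'.1 1 :=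
      (hW w').add_eq_left_of_lt (by simpa using ht w w' hne)
    rw [map_div₀, h, map_one, div_one]
    exact ht w w' hne
  have hsum (w : W) : w.1 (∑ i, e i) = 1 := by
    rw [(hW w).apply_sum_eq_of_lt (fun x ↦ (w.1.map_neg x).symm) (Finset.mem_univ w), he_self]
    intro i _ hi
    rw [he_self]
    exact he_lt hi.symm
  -- Otherwise every `e w` lies in the maximal ideal of `S`, and so does their sum, which is a unit
  -- of `S` because it has absolute value `1` at every conjugate.
  have hunit : ∃ w : W, (e w)⁻¹ ∈ S := by
    by_contra! hcon
    have h1 : S.valuation (∑ i, e i) < 1 := S.valuation.map_sum_lt one_ne_zero fun w _ ↦ by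
      have := (S.valuation_le_one_iff _).not.2 (hcon w)
      rw [not_le, map_inv₀] at this
      exact (one_lt_inv_iff₀.1 this).2
    have h2 : S.valuation (∑ i, e i)⁻¹ ≤ 1 :=
      (S.valuation_le_one_iff _).2 <| hmem fun w ↦ by rw [map_inv₀, hsum, inv_one]
    have h0 : S.valuation (∑ i, e i) ≠ 0 := by
      rw [Valuation.ne_zero_iff]
      intro h0
      have := hsum ⟨a.conj 1, 1, rfl⟩
      rw [h0, map_zero] at this
      exact zero_ne_one this
    rw [map_inv₀] at h2
    exact (one_lt_inv_iff₀.2 ⟨zero_lt_iff.2 h0, h1⟩).not_ge h2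
  obtain ⟨w, hw⟩ := hunit
  have hle : w.1.unitBall (hW w) ≤ S := by
    intro x hx
    -- Powers of `e w` shrink `x` at the other conjugates without changing it at `w`.
    have hlim (w' : W) : ∀ᶠ n : ℕ in Filter.atTop, w'.1 (e w ^ n * x) ≤ 1 := by
      by_cases h : w' = w
      · subst h
        exact .of_forall fun n ↦ by simpa [he_self] using hx
      · have h1 : Filter.Tendsto (fun n : ℕ ↦ w'.1 (e w ^ n * x)) Filter.atTop (𝓝 0) := by
          simpa using (tendsto_pow_atTop_nhds_zero_of_lt_one (w'.1.nonneg _) (he_lt h)).mul_const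
            (w'.1 x)
        exact h1.eventually_le_const one_pos
    obtain ⟨n, hn⟩ := (Filter.eventually_all.2 hlim).exists
    have he0 : e w ≠ 0 := fun h ↦ by simpa [h] using he_self w
    have hxe : x = (e w)⁻¹ ^ n * (e w ^ n * x) := by
      rw [← mul_assoc, ← mul_pow, inv_mul_cancel₀ he0, one_pow, one_mul]
    rw [hxe]
    exact mul_mem (pow_mem hw n) (hmem hn)
  obtain ⟨_, σ, rfl⟩ := w
  refine ⟨σ, (eq_top_or_eq_unitBall _ hle).resolve_left ?_⟩
  rintro rfl
  obtain ⟨k, hk⟩ := hnt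
  exact hk.not_ge ((hS k).1 trivial)

/-- If the conjugates of `a` are pairwise inequivalent, the base field is dense for `a`. -/
theorem exists_algebraMap_sub_lt {a : AbsoluteValue L ℝ} (ha : IsNonarchimedean a)
    (hnt : ∃ k : K, 1 < a (algebraMap K L k))
    (hineq : Pairwise fun σ τ : L ≃ₐ[K] L ↦ ¬ (a.conj σ).IsEquiv (a.conj τ)) (l : L) {ε : ℝ}
    (hε : 0 < ε) : ∃ k : K, a (l - algebraMap K L k) < ε := by
  classical
  have hnontriv (σ : L ≃ₐ[K] L) : (a.conj σ).IsNontrivial := by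
    obtain ⟨k, hk⟩ := hnt
    refine ⟨algebraMap K L k, fun h ↦ ?_, ?_⟩
    · rw [h, map_zero] at hk
      linarith
    · simpa using hk.ne'
  obtain ⟨t, ht⟩ := Metric.denseRange_iff.1 (denseRange_algebraMap_pi hnontriv hineq)
    (fun σ ↦ WithAbs.toAbs (a.conj σ) (if σ = 1 then l else 0)) ε hε
  have ht' (σ : L ≃ₐ[K] L) : a ((if σ = 1 then l else 0) - σ t) < ε := by
    have h := (dist_pi_lt_iff hε).1 ht σ
    rw [dist_eq_norm] at h
    have h' : (a.conj σ) ((if σ = 1 then l else 0) - t) < ε := h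
    have h2 : (a.conj σ) ((if σ = 1 then l else 0) - t) =
        a ((if σ = 1 then l else 0) - σ t) := by
      by_cases hσ : σ = 1 <;> simp [hσ]
    exact h2 ▸ h'
  refine ⟨Algebra.trace K L t, ?_⟩
  have hsum : l - algebraMap K L (Algebra.trace K L t) =
      ∑ σ : L ≃ₐ[K] L, ((if σ = 1 then l else 0) - σ t) := by
    rw [trace_eq_sum_automorphisms, Finset.sum_sub_distrib]
    simp
  rw [hsum]
  obtain ⟨σ, -, hσ⟩ := ha.finset_image_add (map_zero a) a.nonneg
    (fun σ : L ≃ₐ[K] L ↦ (if σ = 1 then l else 0) - σ t) Finset.univ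
  exact hσ.trans_lt (ht' σ)

end Galois

end AbsoluteValue

/-! ### From the valuation to a real absolute value -/

namespace ValuedExtension

variable {K L Γ : Type*} [Field K] [Field L] [Algebra K L]
  [AddCommGroup Γ] [LinearOrder Γ] [IsOrderedAddMonoid Γ]

theorem exists_eq_coe {ν : AddValuation L (WithTop Γ)} {x : L} (hx : x ≠ 0) :
    ∃ γ : Γ, ν x = (γ : WithTop Γ) := by
  obtain ⟨γ, hγ⟩ := WithTop.ne_top_iff_exists.1 ((AddValuation.ne_top_iff ν).2 hx)
  exact ⟨γ, hγ.symm⟩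

/-- An archimedean valuation comes from a nonarchimedean real absolute value. -/
theorem IsArchimedean.exists_absoluteValue {ν : AddValuation L (WithTop Γ)}
    (h : IsArchimedean ν) :
    ∃ a : AbsoluteValue L ℝ, IsNonarchimedean a ∧ ∀ x y, a x ≤ a y ↔ ν y ≤ ν x := by
  classical
  obtain ⟨f, hf⟩ := h
  let g (x : L) (hx : x ≠ 0) : valueGroup ν := ⟨(exists_eq_coe (ν := ν) hx).choose,
    x, (exists_eq_coe (ν := ν) hx).choose_spec⟩
  have hg (x : L) (hx : x ≠ 0) : ν x = ((g x hx : Γ) : WithTop Γ) :=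
    (exists_eq_coe (ν := ν) hx).choose_spec
  have hgmul (x y : L) (hx : x ≠ 0) (hy : y ≠ 0) :
      g (x * y) (mul_ne_zero hx hy) = g x hx + g y hy := by
    apply Subtype.ext
    have h := ν.map_mul x y
    rw [hg _ (mul_ne_zero hx hy), hg x hx, hg y hy] at h
    exact_mod_cast h
  let b (x : L) : ℝ := if hx : x = 0 then 0 else Real.exp (-f (g x hx))
  have hb0 : b 0 = 0 := dif_pos rfl
  have hbne (x : L) (hx : x ≠ 0) : b x = Real.exp (-f (g x hx)) := dif_neg hx
  have hbpos (x : L) (hx : x ≠ 0) : 0 < b x := hbne x hx ▸ Real.exp_pos _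
  have hble (x y : L) : b x ≤ b y ↔ ν y ≤ ν x := by
    by_cases hx : x = 0
    · subst hx
      simp only [hb0, ν.map_zero, le_top, iff_true]
      by_cases hy : y = 0
      · rw [hy, hb0]
      · exact (hbpos y hy).le
    by_cases hy : y = 0
    · subst hy
      rw [hb0, ν.map_zero, top_le_iff, AddValuation.top_iff]
      exact iff_of_false (hbpos x hx).not_ge hx
    rw [hbne x hx, hbne y hy, Real.exp_le_exp, neg_le_neg_iff, hf.le_iff_le, hg x hx, hg y hy,
      WithTop.coe_le_coe, Subtype.coe_le_coe]
  have hbna : IsNonarchimedean b := fun x y ↦ by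
    rw [le_max_iff, hble, hble, ← min_le_iff]
    exact ν.map_add x y
  have hbnonneg (x : L) : 0 ≤ b x := by
    rw [← hb0, hble, ν.map_zero]
    exact le_top
  refine ⟨⟨⟨b, fun x y ↦ ?_⟩, hbnonneg, fun x ↦ ?_, fun x y ↦ ?_⟩, hbna, hble⟩
  · by_cases hx : x = 0
    · rw [hx, zero_mul, hb0, zero_mul]
    by_cases hy : y = 0
    · rw [hy, mul_zero, hb0, mul_zero]
    rw [hbne _ (mul_ne_zero hx hy), hgmul x y hx hy, hbne x hx, hbne y hy, map_add, neg_add,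
      Real.exp_add]
  · refine ⟨fun h ↦ by_contra fun hx ↦ (hbpos x hx).ne' h, ?_⟩
    rintro rfl
    exact hb0
  · exact (hbna x y).trans (max_le_add_of_nonneg (hbnonneg x) (hbnonneg y))

theorem algebraMap_mem_iff_of_mem_extensions {ν : AddValuation L (WithTop Γ)}
    {S : ValuationSubring L} (hS : S ∈ extensions K ν) (k : K) :
    algebraMap K L k ∈ S ↔ 0 ≤ ν (algebraMap K L k) := by
  rw [← S.valuation_le_one_iff]
  exact hS.le_one_iff_le_one (x := k)

/-- Otherwise `0 = ν (0 - 1)` would be the maximum of `ν(0 - K)`. -/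
theorem IsImmediateExtension.exists_pos {ν : AddValuation L (WithTop Γ)}
    (h : IsImmediateExtension K ν) : ∃ k : K, k ≠ 0 ∧ 0 < ν (algebraMap K L k) := by
  by_contra! hcon
  refine (h 0 trivial).2 ⟨0, ⟨1, Submodule.one_le.1 le_rfl, one_ne_zero, by simp⟩, ?_⟩
  rintro γ ⟨x, hx, hx0, hγ⟩
  obtain ⟨k, rfl⟩ := Submodule.mem_one.1 hx
  have hk : k ≠ 0 := by
    rintro rfl
    simp at hx0
  rw [zero_sub, ν.map_neg] at hγ
  have := hcon k hk
  rw [hγ] at this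
  exact_mod_cast this

/-- An immediate extension is dense if every element is approximated to arbitrary precision. -/
theorem IsImmediateExtension.isDenseExtension {ν : AddValuation L (WithTop Γ)}
    (h : IsImmediateExtension K ν)
    (happ : ∀ (l : L) (y : L), y ≠ 0 → ∃ k : K, ν y < ν (l - algebraMap K L k)) :
    IsDenseExtension K ν := by
  refine fun l _ ↦ (h l trivial).1.antisymm ?_
  rintro γ ⟨y, hy, hy0, hγ⟩
  -- In `l - (k - y) = (l - k) + y` the term `y` dominates.
  obtain ⟨k, hk⟩ := happ l y hy0
  have hval : ν (l - (algebraMap K L k - y)) = γ := by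
    rw [← hγ, ← sub_add]
    exact ν.map_add_eq_of_lt_right hk
  refine ⟨algebraMap K L k - y, sub_mem (Submodule.mem_one.2 ⟨k, rfl⟩) hy, ?_, hval⟩
  rintro rfl
  simp at hval

end ValuedExtension

theorem mainTheorem6 {K L Γ : Type*} [Field K] [Field L] [Algebra K L]
    [AddCommGroup Γ] [LinearOrder Γ] [IsOrderedAddMonoid Γ]
    (ν : AddValuation L (WithTop Γ))
    [FiniteDimensional K L] [IsGalois K L]
    (himm : ValuedExtension.IsImmediateExtension K ν)
    (hdef : ValuedExtension.IsDefectless K ν)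
    (harch : ValuedExtension.IsArchimedean ν) :
    ValuedExtension.IsDenseExtension K ν := by
  obtain ⟨a, ha, hle⟩ := harch.exists_absoluteValue
  have hle1 (x : L) : a x ≤ 1 ↔ 0 ≤ ν x := by
    rw [← ν.map_one, ← hle, map_one]
  have hlt (x y : L) : a x < a y ↔ ν y < ν x := lt_iff_lt_of_le_iff_le (hle y x)
  have hnt : ∃ k : K, 1 < a (algebraMap K L k) := by
    obtain ⟨k, hk0, hk⟩ := himm.exists_pos
    rw [← ν.map_one, ← hlt, map_one] at hk
    refine ⟨k⁻¹, ?_⟩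
    rw [map_inv₀, map_inv₀]
    exact one_lt_inv_iff₀.2 ⟨a.pos ((map_ne_zero _).2 hk0), hk⟩
  let F (σ : L ≃ₐ[K] L) : ValuationSubring L :=
    (a.conj σ).unitBall (AbsoluteValue.isNonarchimedean_conj ha σ)
  have hext : ValuedExtension.extensions K ν ⊆ F '' Set.univ := fun S hS ↦ by
    obtain ⟨σ, hσ⟩ := AbsoluteValue.exists_eq_unitBall_conj ha hnt (S := S) fun k ↦ by
      rw [ValuedExtension.algebraMap_mem_iff_of_mem_extensions hS, hle1]
    exact ⟨σ, trivial, hσ.symm⟩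
  have hinj : Function.Injective F := by
    rw [← Set.injOn_univ]
    -- The image of `F` contains all `[L : K]` extensions, and its source has only `[L : K]`
    -- elements.
    refine Set.finite_univ.injOn_of_encard_image_eq ((Set.encard_image_le _ _).antisymm ?_)
    refine le_trans (le_of_eq ?_) (Set.encard_le_encard hext)
    rw [hdef, Set.encard_univ, ENat.card_eq_coe_natCard, IsGalois.card_aut_eq_finrank]
  refine himm.isDenseExtension fun l y hy ↦ ?_
  obtain ⟨k, hk⟩ := AbsoluteValue.exists_algebraMap_sub_lt ha hnt
    (fun σ τ hne h ↦ hne (hinj (h.unitBall_eq _ _))) l (a.pos hy)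
  exact ⟨k, (hlt _ _).1 hk⟩
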